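/- Let $d\ge 3$, let $\mathcal T$ be the $d$-regular tree, and let $\iota$ be a legal colouring of $\mathcal T$, i.e. a map from the set of unoriented edges to $\{1,\dots,d\}$ whose restriction $\iota|_{E(v)}$ to the set $E(v)$ of edges at $v$ is a bijection onto $\{1,\dots,d\}$, for every vertex $v$. Equip $\mathrm{Aut}(\mathcal T)$ with the compact-open topology. Let $F$ be a primitive subgroup of $\mathrm{Sym}\{1,\dots,d\}$, let $$U(F)=\{g\in \mathrm{Aut}(\mathcal T) : \iota\circ g\circ(\iota|_{E(v)})^{-1}\in F \text{ for every vertex } v\},$$ and let $\mathbb G=U(F)^+$ be the subgroup of $U(F)$ generated by the elements of $U(F)$ that fix both endpoints of some edge, with the subspace topology. Fix a vertex $x$ and an edge $e$ containing $x$. Let $K=\mathbb G_x$ be the stabilizer of $x$ in $\mathbb G$, and let $\mathcal T_{x,e}$ be the half-tree emanating from $x$ and containing $e$: it consists of $x$ and of all vertices $v$ such that the geodesic from $x$ to $v$ starts with $e$. For $\gamma\in\mathbb G$ let $|\gamma|=\min_v \operatorname{dist}(v,\gamma v)$ and $\mathrm{Min}(\gamma)=\{v : \operatorname{dist}(v,\gamma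 v)=|\gamma|\}$, where $v$ runs over the vertices. Call $\gamma$ hyperbolic if it fixes no vertex and inverts no edge. Let $A^+\subset\mathbb G$ consist of the identity and of all hyperbolic $\gamma\in\mathbb G$ with $e\subset\mathrm{Min}(\gamma)$ and $\gamma(e)\subset\mathcal T_{x,e}$. Let $\mu$ be a left Haar measure on $\mathbb G$ and let $$(f_1*f_2)(h)=\int_{\mathbb G}f_1(hg)\,f_2(g^{-1})\,d\mu(g).$$ For a function $f=\sum_{i\in I}a_i\mathbb 1_{K\eta_iK}$ with $I$ finite, $a_i\in\mathbb C$, $\eta_i\in A^+$ and the double cosets $K\eta_iK$ pairwise distinct, the coefficient $a_i$ is called maximal if $K\eta_iK$ is contained in the support of $f$ and $|\eta_i|$ is the largest of the numbers $|\eta|$ with $\eta\in A^+$ and $K\eta K$ contained in the support of $f$. Let $\gamma_1,\gamma_2\in A^+$. Then every maximal coefficient of $\mathbb 1_{K\gamma_1K}*\mathbb 1_{K\gamma_2K}$ equals $\mu(K)$. In particular, if $\mu$ is normalized so that $\mu(K)=1$, then all these maximal coefficients equal $1$. -/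

import Mathlib

open MeasureTheory

namespace BurgerMozes

universe u

variable {V : Type u}

/-- The compact-open topology on the automorphism group of a graph whose vertex set is discrete:
compact subsets of a discrete space are finite, so this is the topology of pointwise convergence,
induced by the product topology on `V → V` with `V` discrete. -/
instance autTopology (T : SimpleGraph V) : TopologicalSpace (T ≃g T) :=
  TopologicalSpace.induced (fun (g : T ≃g T) (v : V) => g v)
    (@Pi.topologicalSpace V (fun _ => V) (fun _ => ⊥))

/-- A legal colouring: the colours of the edges in the star of each vertex are in bijection with
the set of the `d` colours. -/
def IsLegalColoring (T : SimpleGraph V) {d : ℕ} (ι : T.edgeSet → Fin d) : Prop :=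
  ∀ v : V, Set.BijOn ι {e | v ∈ (e : Sym2 V)} Set.univ

/-- The universal group `U(F)`: the automorphisms `g` whose local action at every vertex `v`, the
permutation `ι ∘ g ∘ (ι|E(v))⁻¹` of the colours, lies in `F`. -/
def universalGroup (T : SimpleGraph V) {d : ℕ} (ι : T.edgeSet → Fin d)
    (F : Subgroup (Equiv.Perm (Fin d))) : Subgroup (T ≃g T) where
  carrier := {g | ∀ v : V, ∃ σ ∈ F, ∀ e : T.edgeSet, v ∈ (e : Sym2 V) →
    ι (g.mapEdgeSet e) = σ (ι e)}
  one_mem' := by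
    intro v
    refine ⟨1, F.one_mem, fun e _ => ?_⟩
    have h : SimpleGraph.Iso.mapEdgeSet (1 : T ≃g T) e = e := by
      apply Subtype.ext
      change Sym2.map (fun w => w) (e : Sym2 V) = e
      exact congrFun Sym2.map_id (e : Sym2 V)
    rw [h]; rfl
  mul_mem' := by
    intro g h hg hh v
    obtain ⟨τ, hτ, hτe⟩ := hh v
    obtain ⟨σ, hσ, hσe⟩ := hg (h v)
    refine ⟨σ * τ, F.mul_mem hσ hτ, fun e he => ?_⟩
    have hcomp : SimpleGraph.Iso.mapEdgeSet (g * h) e = g.mapEdgeSet (h.mapEdgeSet e) := by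
      apply Subtype.ext
      change Sym2.map (fun w => g (h w)) (e : Sym2 V) = Sym2.map g (Sym2.map h (e : Sym2 V))
      rw [Sym2.map_map]; rfl
    have hmem : h v ∈ ((h.mapEdgeSet e : T.edgeSet) : Sym2 V) :=
      Sym2.mem_map.2 ⟨v, he, rfl⟩
    rw [hcomp, hσe _ hmem, hτe e he]; rfl
  inv_mem' := by
    intro g hg v
    obtain ⟨σ, hσ, hσe⟩ := hg (g.symm v)
    refine ⟨σ⁻¹, F.inv_mem hσ, fun e he => ?_⟩
    have hmem : g.symm v ∈ ((g.mapEdgeSet.symm e : T.edgeSet) : Sym2 V) :=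
      Sym2.mem_map.2 ⟨v, he, rfl⟩
    have h := hσe _ hmem
    rw [Equiv.apply_symm_apply] at h
    exact (σ.symm_apply_eq.2 h).symm

/-- `U(F)⁺`: the subgroup generated by the elements of `U(F)` that fix an edge (pointwise). -/
def universalGroupPlus (T : SimpleGraph V) {d : ℕ} (ι : T.edgeSet → Fin d)
    (F : Subgroup (Equiv.Perm (Fin d))) : Subgroup (T ≃g T) :=
  Subgroup.closure {g | g ∈ universalGroup T ι F ∧ ∃ v w : V, T.Adj v w ∧ g v = v ∧ g w = w}

section Tree

variable (T : SimpleGraph V)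

/-- The translation length `|g|`, the minimal displacement of a vertex; `|id| = 0`. -/
noncomputable def translationLength (g : T ≃g T) : ℕ := ⨅ v : V, T.dist v (g v)

/-- `Min(g)`: the vertices whose displacement is minimal. -/
def minSet (g : T ≃g T) : Set V := {v | T.dist v (g v) = translationLength T g}

/-- An automorphism of a tree is hyperbolic when it neither fixes a vertex nor inverts an edge. -/
def IsHyperbolic (g : T ≃g T) : Prop :=
  (∀ v : V, g v ≠ v) ∧ ¬ ∃ v w : V, T.Adj v w ∧ g v = w ∧ g w = v

/-- The half-tree emanating from `x` and containing the edge `e = {x, y}`: it consists of `x` and of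
the vertices `v` such that the geodesic from `x` to `v` starts with `e`. -/
def halfTree (x y : V) : Set V := {v | v = x ∨ T.dist x v = T.dist y v + 1}

variable (G : Subgroup (T ≃g T)) (x y : V)

/-- The stabilizer in `G` of the vertex `x`. -/
def vertexStabilizer : Subgroup G where
  carrier := {g | (g : T ≃g T) x = x}
  one_mem' := rfl
  mul_mem' := by
    intro g h hg hh
    change (g : T ≃g T) ((h : T ≃g T) x) = x
    rw [show (h : T ≃g T) x = x from hh]; exact hg
  inv_mem' := by
    intro g hg
    change (g : T ≃g T).symm x = x
    rw [RelIso.symm_apply_eq]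
    exact (show (g : T ≃g T) x = x from hg).symm

/-- `A⁺` for the edge `e = {x, y}`: the identity, and the hyperbolic elements of `G` with
`e ⊆ Min(γ)` that translate `e` inside the half-tree emanating from `x` and containing `e`. -/
def APlus : Set G :=
  {γ | IsHyperbolic T (γ : T ≃g T) ∧
      (x ∈ minSet T (γ : T ≃g T) ∧ y ∈ minSet T (γ : T ≃g T)) ∧
      ((γ : T ≃g T) x ∈ halfTree T x y ∧ (γ : T ≃g T) y ∈ halfTree T x y)} ∪ {1}

/-- The double coset `K γ K`, where `K` is the stabilizer of `x`. -/
def KDoubleCoset (γ : G) : Set G :=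
  DoubleCoset.doubleCoset γ (vertexStabilizer T G x : Set G) (vertexStabilizer T G x : Set G)

/-- The indicator function of `K γ K`, with complex values. -/
noncomputable def doubleCosetIndicator (γ : G) : G → ℂ :=
  (KDoubleCoset T G x γ).indicator (fun _ => (1 : ℂ))

/-- `K η K` is a maximal `K`-double coset of `X`: it lies in `X`, and `|η|` is maximal among the
`η' ∈ A⁺` with `K η' K` contained in `X`. -/
def IsMaximalDoubleCoset (X : Set G) (η : G) : Prop :=
  η ∈ APlus T G x y ∧ KDoubleCoset T G x η ⊆ X ∧
    ∀ η' ∈ APlus T G x y, KDoubleCoset T G x η' ⊆ X →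
      translationLength T (η' : T ≃g T) ≤ translationLength T (η : T ≃g T)

/-- `a` is a maximal coefficient of `f`: in a decomposition `f = ∑ cᵢ 1_{K ηᵢ K}` over finitely many
pairwise distinct double cosets with `ηᵢ ∈ A⁺`, it is the coefficient of a maximal double coset of
the support of `f`. -/
def IsMaximalCoefficient (f : G → ℂ) (a : ℂ) : Prop :=
  ∃ (n : ℕ) (η : Fin n → G) (c : Fin n → ℂ),
    (∀ i, η i ∈ APlus T G x y) ∧
    Function.Injective (fun i => KDoubleCoset T G x (η i)) ∧
    (f = fun h => ∑ i, c i * doubleCosetIndicator T G x (η i) h) ∧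
    ∃ i, IsMaximalDoubleCoset T G x y (Function.support f) (η i) ∧ a = c i

end Tree

/-- The convolution `(f₁ ∗ f₂)(h) = ∫ f₁(h g) f₂(g⁻¹) dμ(g)`. -/
noncomputable def convolution {G : Type*} [Group G] [MeasurableSpace G] (μ : Measure G)
    (f₁ f₂ : G → ℂ) (h : G) : ℂ :=
  ∫ g, f₁ (h * g) * f₂ g⁻¹ ∂μ

end BurgerMozes

namespace BurgerMozes

universe u

/-! ### Geodesics and translations in a tree -/

section TreeDist

variable {V : Type u} {T : SimpleGraph V}

/-! Write `K` for the stabilizer of `x`. The convolution at `h` is the measure of the fibre of those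
`g` with `h g ∈ K γ₁ K` and `g⁻¹ ∈ K γ₂ K`. This fibre is a union of left cosets `g K`, that is, a
set of vertices `g x`, each at distance `|γ₂|` from `x` and `|γ₁|` from `h⁻¹ x`. Hence `d(x, h x) ≤
|γ₁| + |γ₂|` on the support (`dist_le_of_mem_convolutionFiber`).

The bound is attained: elements of `A⁺` push the edge `{x, y}` in the same direction, so `γ₁ γ₂ ∈
A⁺` and lengths add (`mul_mem_APlus`). A maximal double coset therefore has length exactly `|γ₁| +
|γ₂|`. There `g x` must be the unique point of the geodesic from `x` to `h⁻¹ x` at distance `|γ₂|`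
from `x`, so the fibre is one coset of `K` (`convolutionFiber_eq_preimage`), of measure `μ(K)`. -/

lemma dist_add_dist_le_length_of_mem_support {a b w : V} (p : T.Walk a b) (hw : w ∈ p.support) :
    T.dist a w + T.dist w b ≤ p.length := by
  classical
  have h := congrArg SimpleGraph.Walk.length (p.take_spec hw)
  rw [SimpleGraph.Walk.length_append] at h
  have h1 := SimpleGraph.dist_le (p.takeUntil w hw)
  have h2 := SimpleGraph.dist_le (p.dropUntil w hw)
  omega

lemma length_eq_dist_of_isPath (hT : T.IsTree) {a b : V} (p : T.Walk a b) (hp : p.IsPath) :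
    p.length = T.dist a b := by
  obtain ⟨q, hq, hl⟩ := hT.connected.exists_path_of_dist a b
  have h : (⟨p, hp⟩ : T.Path a b) = ⟨q, hq⟩ := (hT.isAcyclic.subsingleton_path _ _).elim _ _
  rw [← hl, show p = q from congrArg Subtype.val h]

/-- In a tree, a geodesic ending at `u` and leaving `v` behind can be continued by a geodesic
that starts with the edge `{u, v}`. -/
lemma dist_eq_add_of_adj (hT : T.IsTree) {a b u v : V} (huv : T.Adj u v)
    (ha : T.dist a v = T.dist a u + 1) (hb : T.dist u b = T.dist v b + 1) :
    T.dist a b = T.dist a u + T.dist u b := by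
  obtain ⟨p, hp, hpl⟩ := hT.connected.exists_path_of_dist a u
  obtain ⟨q, hq, hql⟩ := hT.connected.exists_path_of_dist v b
  have hr : (p.append (SimpleGraph.Walk.cons huv q)).IsPath := by
    rw [SimpleGraph.Walk.isPath_def, SimpleGraph.Walk.support_append,
      SimpleGraph.Walk.support_cons, List.tail_cons]
    refine List.nodup_append.2 ⟨hp.support_nodup, hq.support_nodup, ?_⟩
    -- At a common vertex `w`, the triangle inequalities through `w` give `d(a, v) + d(u, b) ≤ d(a,
    -- u) + d(v, b)`, whereas the hypotheses make the left side larger by 2.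
    rintro w hwp _ hwq rfl
    have h1 := dist_add_dist_le_length_of_mem_support p hwp
    have h2 := dist_add_dist_le_length_of_mem_support q hwq
    have h3 := hT.connected.dist_triangle (u := a) (v := w) (w := v)
    have h4 := hT.connected.dist_triangle (u := u) (v := w) (w := b)
    rw [SimpleGraph.dist_comm (u := w) (v := v)] at h3
    rw [SimpleGraph.dist_comm (u := u) (v := w)] at h4
    omega
  have h := length_eq_dist_of_isPath hT _ hr
  rw [SimpleGraph.Walk.length_append, SimpleGraph.Walk.length_cons] at h
  omega

/-- A point of a geodesic in a tree is determined by its distances to the endpoints. -/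
lemma eq_of_dist_eq_of_dist_add_eq (hT : T.IsTree) {x z v w : V}
    (h : T.dist x z = T.dist x v + T.dist v z) (hx : T.dist x w = T.dist x v)
    (hz : T.dist w z = T.dist v z) : v = w := by
  obtain ⟨p, hp⟩ := hT.connected.exists_walk_length_eq_dist x v
  obtain ⟨p', hp'⟩ := hT.connected.exists_walk_length_eq_dist v z
  obtain ⟨q, hq⟩ := hT.connected.exists_walk_length_eq_dist x w
  obtain ⟨q', hq'⟩ := hT.connected.exists_walk_length_eq_dist w z
  have h1 : (p.append p').IsPath := SimpleGraph.Walk.isPath_of_length_eq_dist _ (by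
    rw [SimpleGraph.Walk.length_append]; omega)
  have h2 : (q.append q').IsPath := SimpleGraph.Walk.isPath_of_length_eq_dist _ (by
    rw [SimpleGraph.Walk.length_append]; omega)
  have h3 : (⟨_, h1⟩ : T.Path x z) = ⟨_, h2⟩ := (hT.isAcyclic.subsingleton_path _ _).elim _ _
  have h4 := congrArg (fun r : T.Path x z => (r : T.Walk x z).getVert p.length) h3
  have hl : p.length = q.length := by omega
  simp only [SimpleGraph.Walk.getVert_append, lt_irrefl, if_false, Nat.sub_self,
    SimpleGraph.Walk.getVert_zero] at h4
  rw [hl] at h4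
  simpa using h4

lemma dist_apply_apply (hT : T.IsTree) (g : T ≃g T) (v w : V) :
    T.dist (g v) (g w) = T.dist v w := by
  have key : ∀ (k : T ≃g T) (a b : V), T.dist (k a) (k b) ≤ T.dist a b := by
    intro k a b
    obtain ⟨p, hp⟩ := hT.connected.exists_walk_length_eq_dist a b
    have h := SimpleGraph.dist_le (p.map k.toHom)
    rw [SimpleGraph.Walk.length_map, hp] at h
    exact h
  refine le_antisymm (key g v w) ?_
  have h := key g.symm (g v) (g w)
  rwa [RelIso.symm_apply_apply, RelIso.symm_apply_apply] at h

lemma dist_inv_apply (hT : T.IsTree) (g : T ≃g T) (v w : V) :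
    T.dist (g⁻¹ v) w = T.dist v (g w) := by
  rw [← dist_apply_apply hT g (g⁻¹ v) w]
  exact congrArg (fun a => T.dist a (g w)) (g.apply_symm_apply v)

lemma translationLength_le (g : T ≃g T) (v : V) : translationLength T g ≤ T.dist v (g v) :=
  ciInf_le (OrderBot.bddBelow _) v

/-- `g` moves the oriented edge `(x, y)` forward, by `n` steps, along a geodesic. -/
structure Advances (T : SimpleGraph V) (x y : V) (g : T ≃g T) (n : ℕ) : Prop where
  left_left : T.dist x (g x) = n
  right_right : T.dist y (g y) = n
  left_right : T.dist x (g y) = n + 1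
  right_left : T.dist y (g x) + 1 = n

/-- Seen from `x` or `y`, the edge from `g x` to `g y` points away; seen from the images of `x` and
`y` under `g h`, it points back. All four geodesics thus pass through `g x`, and their lengths split
there. -/
lemma Advances.mul (hT : T.IsTree) {x y : V} (hxy : T.Adj x y) {g h : T ≃g T} {m n : ℕ}
    (hg : Advances T x y g m) (hh : Advances T x y h n) : Advances T x y (g * h) (m + n) := by
  have hadj : T.Adj (g x) (g y) := g.map_adj_iff.2 hxy
  have e : ∀ v w, T.dist (g v) ((g * h) w) = T.dist v (h w) := fun v w =>
    dist_apply_apply hT g v (h w)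
  obtain ⟨g1, g2, g3, g4⟩ := hg
  obtain ⟨h1, h2, h3, h4⟩ := hh
  have exx := e x x
  have exy := e x y
  have eyx := e y x
  have eyy := e y y
  have k1 := dist_eq_add_of_adj hT (a := x) (b := (g * h) x) hadj (by omega) (by omega)
  have k2 := dist_eq_add_of_adj hT (a := y) (b := (g * h) x) hadj (by omega) (by omega)
  have k3 := dist_eq_add_of_adj hT (a := x) (b := (g * h) y) hadj (by omega) (by omega)
  have k4 := dist_eq_add_of_adj hT (a := y) (b := (g * h) y) hadj (by omega) (by omega)
  constructor <;> omega

lemma Advances.pow (hT : T.IsTree) {x y : V} (hxy : T.Adj x y) {g : T ≃g T} {n : ℕ}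
    (hg : Advances T x y g n) (k : ℕ) : Advances T x y (g ^ (k + 1)) ((k + 1) * n) := by
  induction k with
  | zero => simpa using hg
  | succ k ih =>
    rw [pow_succ, Nat.succ_mul]
    exact ih.mul hT hxy hg

lemma dist_pow_apply_le (hT : T.IsTree) (g : T ≃g T) (v : V) (k : ℕ) :
    T.dist v ((g ^ k) v) ≤ k * T.dist v (g v) := by
  induction k with
  | zero => simp
  | succ k ih =>
    have h := hT.connected.dist_triangle (u := v) (v := (g ^ k) v) (w := (g ^ (k + 1)) v)
    have e : T.dist ((g ^ k) v) ((g ^ (k + 1)) v) = T.dist v (g v) := by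
      rw [pow_succ]; exact dist_apply_apply hT (g ^ k) v (g v)
    rw [Nat.succ_mul]
    omega

/-- Powers amplify any deficit: `g ^ k` moves `x` by exactly `k n`, but by at most `2 d(x, v) + k
d(v, g v)`. If `d(v, g v) ≤ n - 1`, this fails at `k = 2 d(x, v) + 1`. -/
lemma Advances.le_dist (hT : T.IsTree) {x y : V} (hxy : T.Adj x y) {g : T ≃g T} {n : ℕ}
    (hg : Advances T x y g n) (v : V) : n ≤ T.dist v (g v) := by
  by_contra! hlt
  have h1 := (hg.pow hT hxy (2 * T.dist x v)).left_left
  have h2 := dist_pow_apply_le hT g v (2 * T.dist x v + 1)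
  generalize g ^ (2 * T.dist x v + 1) = k at h1 h2
  have h3 := hT.connected.dist_triangle (u := x) (v := v) (w := k x)
  have h4 := hT.connected.dist_triangle (u := v) (v := k v) (w := k x)
  rw [dist_apply_apply hT, SimpleGraph.dist_comm (u := v) (v := x)] at h4
  have h5 : (2 * T.dist x v + 1) * (T.dist v (g v) + 1) ≤ (2 * T.dist x v + 1) * n :=
    Nat.mul_le_mul_left _ hlt
  rw [Nat.mul_succ] at h5
  omega

lemma Advances.translationLength_eq (hT : T.IsTree) {x y : V} (hxy : T.Adj x y) {g : T ≃g T}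
    {n : ℕ} (hg : Advances T x y g n) : translationLength T g = n := by
  have : Nonempty V := ⟨x⟩
  exact le_antisymm (hg.left_left ▸ translationLength_le g x) (le_ciInf (hg.le_dist hT hxy))

variable {G : Subgroup (T ≃g T)} {x y : V}

lemma Advances.mem_APlus (hT : T.IsTree) (hxy : T.Adj x y) {γ : G} {n : ℕ}
    (h : Advances T x y (γ : T ≃g T) n) (hn : 2 ≤ n) : γ ∈ APlus T G x y := by
  have hl := h.translationLength_eq hT hxy
  refine Or.inl ⟨⟨fun v hv => ?_, ?_⟩, ⟨h.left_left.trans hl.symm, h.right_right.trans hl.symm⟩,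
    Or.inr ?_, Or.inr ?_⟩
  · have := h.le_dist hT hxy v
    rw [hv, SimpleGraph.dist_self] at this
    omega
  · rintro ⟨v, w, hvw, hv, -⟩
    have := h.le_dist hT hxy v
    rw [hv, SimpleGraph.dist_eq_one_iff_adj.2 hvw] at this
    omega
  · rw [h.left_left, h.right_left]
  · rw [h.left_right, h.right_right]

/-- A non-trivial element of `A⁺` advances the oriented edge `(x, y)` by its translation length. -/
lemma advances_of_mem_APlus (hT : T.IsTree) (hxy : T.Adj x y) {γ : G} (hγ : γ ∈ APlus T G x y)
    (hne : γ ≠ 1) : Advances T x y (γ : T ≃g T) (translationLength T (γ : T ≃g T)) := by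
  obtain ⟨⟨hfix, hinv⟩, ⟨hx, hy⟩, hgx, hgy⟩ | h1 := hγ
  · have hx' : T.dist x ((γ : T ≃g T) x) = translationLength T (γ : T ≃g T) := hx
    have hy' : T.dist y ((γ : T ≃g T) y) = translationLength T (γ : T ≃g T) := hy
    have hgx' := hgx.resolve_left (hfix x)
    refine ⟨hx', hy', ?_, by omega⟩
    -- If `γ y = x`, the translation length is 1, which forces `γ x = y`: the edge would be
    -- inverted.
    rcases hgy with hgy | hgy
    · rw [hgy, SimpleGraph.dist_eq_one_iff_adj.2 hxy.symm] at hy'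
      have : T.dist y ((γ : T ≃g T) x) = 0 := by omega
      exact absurd ⟨x, y, hxy, (hT.connected.dist_eq_zero_iff.1 this).symm, hgy⟩ hinv
    · rw [hgy, hy']
  · exact absurd h1 hne

lemma dist_eq_translationLength_of_mem_APlus {γ : G} (hγ : γ ∈ APlus T G x y) :
    T.dist x ((γ : T ≃g T) x) = translationLength T (γ : T ≃g T) := by
  obtain ⟨-, ⟨hx, -⟩, -⟩ | h1 := hγ
  · exact hx
  · rw [Set.mem_singleton_iff] at h1
    have h := translationLength_le (γ : T ≃g T) x
    have h0 : T.dist x ((γ : T ≃g T) x) = 0 := by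
      rw [h1]; exact SimpleGraph.dist_self
    omega

lemma mul_mem_APlus (hT : T.IsTree) (hxy : T.Adj x y) {γ₁ γ₂ : G} (h₁ : γ₁ ∈ APlus T G x y)
    (h₂ : γ₂ ∈ APlus T G x y) : γ₁ * γ₂ ∈ APlus T G x y ∧
      translationLength T ((γ₁ * γ₂ : G) : T ≃g T) =
        translationLength T (γ₁ : T ≃g T) + translationLength T (γ₂ : T ≃g T) := by
  have h0 : translationLength T ((1 : G) : T ≃g T) = 0 := by
    rw [← dist_eq_translationLength_of_mem_APlus (x := x) (y := y) (Or.inr rfl)]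
    exact SimpleGraph.dist_self
  -- The identity does not satisfy `Advances`, whose field `right_left` forces a positive length.
  by_cases e₁ : γ₁ = 1
  · subst e₁
    rw [one_mul, h0, zero_add]
    exact ⟨h₂, rfl⟩
  by_cases e₂ : γ₂ = 1
  · subst e₂
    rw [mul_one, h0, add_zero]
    exact ⟨h₁, rfl⟩
  have a₁ := advances_of_mem_APlus hT hxy h₁ e₁
  have a₂ := advances_of_mem_APlus hT hxy h₂ e₂
  -- Both lengths are at least 1, so their sum is at least 2, enough to exclude fixed vertices and
  -- inversions.
  have p₁ := a₁.right_left
  have p₂ := a₂.right_left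
  have a : Advances T x y ((γ₁ * γ₂ : G) : T ≃g T) _ := a₁.mul hT hxy a₂
  exact ⟨a.mem_APlus hT hxy (by omega), a.translationLength_eq hT hxy⟩

lemma dist_eq_of_mem_KDoubleCoset (hT : T.IsTree) {γ g : G} (hg : g ∈ KDoubleCoset T G x γ) :
    T.dist x ((g : T ≃g T) x) = T.dist x ((γ : T ≃g T) x) := by
  obtain ⟨k, hk, l, hl, rfl⟩ := DoubleCoset.mem_doubleCoset.1 hg
  have hk' : (k : T ≃g T) x = x := hk
  have hl' : (l : T ≃g T) x = x := hl
  change T.dist x ((k : T ≃g T) ((γ : T ≃g T) ((l : T ≃g T) x))) = _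
  have h := dist_apply_apply hT (k : T ≃g T) x ((γ : T ≃g T) x)
  rw [hk'] at h
  rw [hl', h]

end TreeDist

/-! ### Open stabilizers and left translations -/

section Topology

variable {V : Type u} {T : SimpleGraph V} {G : Subgroup (T ≃g T)}

lemma continuous_apply_vertex (v : V) :
    @Continuous G V _ ⊥ (fun g => (g : T ≃g T) v) := by
  let _ : TopologicalSpace V := ⊥
  have h1 : Continuous (fun (g : T ≃g T) (v : V) => g v) := continuous_induced_dom
  exact (continuous_apply v).comp (h1.comp continuous_subtype_val)

lemma isOpen_vertexStabilizer (x : V) : IsOpen (vertexStabilizer T G x : Set G) := by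
  let _ : TopologicalSpace V := ⊥
  have : DiscreteTopology V := ⟨rfl⟩
  exact (isOpen_discrete ({x} : Set V)).preimage (continuous_apply_vertex x)

lemma continuous_mul_left_aut (g : G) : Continuous (fun h : G => g * h) := by
  let _ : TopologicalSpace V := ⊥
  have : DiscreteTopology V := ⟨rfl⟩
  refine Continuous.subtype_mk (continuous_induced_rng.2 (continuous_pi fun v => ?_)) _
  exact (continuous_of_discreteTopology (f := fun w : V => (g : T ≃g T) w)).comp
    (continuous_apply_vertex v)

/-- Such a set is a union of left cosets of the stabilizer, each the preimage of an open subgroup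
under a left translation. -/
lemma isOpen_of_mul_vertexStabilizer_mem {x : V} {S : Set G}
    (hS : ∀ g ∈ S, ∀ k ∈ vertexStabilizer T G x, g * k ∈ S) : IsOpen S := by
  refine isOpen_iff_forall_mem_open.2 fun g hg => ⟨(fun h => g⁻¹ * h) ⁻¹' vertexStabilizer T G x,
    fun h hh => ?_, (isOpen_vertexStabilizer x).preimage (continuous_mul_left_aut _), ?_⟩
  · simpa using hS g hg _ hh
  · change g⁻¹ * g ∈ vertexStabilizer T G x
    rw [inv_mul_cancel]
    exact one_mem _

variable [MeasurableSpace G] [BorelSpace G]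

lemma measure_preimage_mul_left (μ : Measure G) [μ.IsMulLeftInvariant] (g : G) {S : Set G}
    (hS : IsOpen S) : μ ((fun h => g * h) ⁻¹' S) = μ S := by
  conv_rhs => rw [← map_mul_left_eq_self μ g]
  rw [Measure.map_apply (continuous_mul_left_aut g).measurable hS.measurableSet]

end Topology

/-! ### Convolution of double coset indicators -/

section Convolution

variable {V : Type u} {T : SimpleGraph V} {G : Subgroup (T ≃g T)} {x y : V}

lemma mul_mem_KDoubleCoset {γ g k l : G} (hg : g ∈ KDoubleCoset T G x γ)
    (hk : k ∈ vertexStabilizer T G x) (hl : l ∈ vertexStabilizer T G x) :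
    k * g * l ∈ KDoubleCoset T G x γ := by
  obtain ⟨k', hk', l', hl', rfl⟩ := DoubleCoset.mem_doubleCoset.1 hg
  exact DoubleCoset.mem_doubleCoset.2 ⟨k * k', mul_mem hk hk', l' * l, mul_mem hl' hl, by group⟩

lemma self_mem_KDoubleCoset (γ : G) : γ ∈ KDoubleCoset T G x γ :=
  DoubleCoset.mem_doubleCoset_self _ _ γ

lemma doubleCosetIndicator_congr {γ g h : G} (hg : g ∈ KDoubleCoset T G x h) :
    doubleCosetIndicator T G x γ g = doubleCosetIndicator T G x γ h := by
  obtain ⟨k, hk, l, hl, rfl⟩ := DoubleCoset.mem_doubleCoset.1 hg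
  have : k * h * l ∈ KDoubleCoset T G x γ ↔ h ∈ KDoubleCoset T G x γ := by
    refine ⟨fun H => ?_, fun H => mul_mem_KDoubleCoset H hk hl⟩
    have := mul_mem_KDoubleCoset H (inv_mem hk) (inv_mem hl)
    rwa [show k⁻¹ * (k * h * l) * l⁻¹ = h by group] at this
  classical
  simp only [doubleCosetIndicator, Set.indicator_apply, this]

lemma doubleCosetIndicator_eq_ite {γ h : G} [Decidable (KDoubleCoset T G x γ = KDoubleCoset T G x h)] :
    doubleCosetIndicator T G x γ h =
      if KDoubleCoset T G x γ = KDoubleCoset T G x h then 1 else 0 := by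
  classical
  have : h ∈ KDoubleCoset T G x γ ↔ KDoubleCoset T G x γ = KDoubleCoset T G x h :=
    ⟨fun H => (DoubleCoset.doubleCoset_eq_of_mem H).symm, fun H => H ▸ self_mem_KDoubleCoset h⟩
  simp only [doubleCosetIndicator, Set.indicator_apply, this]

/-- The set over which the convolution of `1_{K γ₁ K}` and `1_{K γ₂ K}` at `h` is computed. -/
def convolutionFiber (x : V) (γ₁ γ₂ h : G) : Set G :=
  {g | h * g ∈ KDoubleCoset T G x γ₁ ∧ g⁻¹ ∈ KDoubleCoset T G x γ₂}

lemma mul_mem_convolutionFiber {γ₁ γ₂ h g k : G} (hg : g ∈ convolutionFiber x γ₁ γ₂ h)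
    (hk : k ∈ vertexStabilizer T G x) : g * k ∈ convolutionFiber x γ₁ γ₂ h := by
  refine ⟨?_, ?_⟩
  · simpa [mul_assoc] using mul_mem_KDoubleCoset hg.1 (one_mem _) hk
  · simpa using mul_mem_KDoubleCoset hg.2 (inv_mem hk) (one_mem _)

lemma isOpen_convolutionFiber (γ₁ γ₂ h : G) : IsOpen (convolutionFiber x γ₁ γ₂ h) :=
  isOpen_of_mul_vertexStabilizer_mem fun _ hg _ hk => mul_mem_convolutionFiber hg hk

lemma convolution_doubleCosetIndicator [MeasurableSpace G] [BorelSpace G] (μ : Measure G)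
    (γ₁ γ₂ h : G) :
    convolution μ (doubleCosetIndicator T G x γ₁) (doubleCosetIndicator T G x γ₂) h =
      (μ.real (convolutionFiber x γ₁ γ₂ h) : ℂ) := by
  classical
  have : (fun g => doubleCosetIndicator T G x γ₁ (h * g) * doubleCosetIndicator T G x γ₂ g⁻¹) =
      (convolutionFiber x γ₁ γ₂ h).indicator (fun _ => (1 : ℂ)) := by
    funext g
    simp only [doubleCosetIndicator, Set.indicator_apply, convolutionFiber, Set.mem_ofPred_eq,
      ite_and]
    split_ifs <;> simp
  rw [convolution, this, integral_indicator_const _ (isOpen_convolutionFiber γ₁ γ₂ h).measurableSet]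
  simp

/-- Double coset conditions on `g` turn into distance conditions on the vertex `g x`, because `K`
fixes `x` and acts by isometries. -/
lemma dist_of_mem_convolutionFiber (hT : T.IsTree) {γ₁ γ₂ h g : G}
    (hg : g ∈ convolutionFiber x γ₁ γ₂ h) :
    T.dist x ((g : T ≃g T) x) = T.dist x ((γ₂ : T ≃g T) x) ∧
      T.dist ((g : T ≃g T) x) ((h : T ≃g T)⁻¹ x) = T.dist x ((γ₁ : T ≃g T) x) := by
  have h1 : T.dist x ((h : T ≃g T) ((g : T ≃g T) x)) = _ := dist_eq_of_mem_KDoubleCoset hT hg.1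
  have h2 : T.dist x ((g : T ≃g T)⁻¹ x) = _ := dist_eq_of_mem_KDoubleCoset hT hg.2
  refine ⟨?_, ?_⟩
  · rw [← h2, ← dist_inv_apply hT, SimpleGraph.dist_comm]
  · rw [← h1, SimpleGraph.dist_comm, dist_inv_apply hT]

lemma dist_inv_apply_self (hT : T.IsTree) (g : T ≃g T) (v : V) :
    T.dist v (g⁻¹ v) = T.dist v (g v) := by
  rw [SimpleGraph.dist_comm, dist_inv_apply hT]

lemma dist_le_of_mem_convolutionFiber (hT : T.IsTree) {γ₁ γ₂ h g : G}
    (hg : g ∈ convolutionFiber x γ₁ γ₂ h) :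
    T.dist x ((h : T ≃g T) x) ≤
      T.dist x ((γ₁ : T ≃g T) x) + T.dist x ((γ₂ : T ≃g T) x) := by
  obtain ⟨h1, h2⟩ := dist_of_mem_convolutionFiber hT hg
  rw [← dist_inv_apply_self hT, ← h1, ← h2, add_comm]
  exact hT.connected.dist_triangle

/-- When the displacements of `x` add up, the fibre is a single left coset of the stabilizer: its
elements move `x` to the point of the geodesic from `x` to `h⁻¹ x` at distance `d(x, γ₂ x)`. -/
lemma convolutionFiber_eq_preimage (hT : T.IsTree) {γ₁ γ₂ h g : G}
    (hg : g ∈ convolutionFiber x γ₁ γ₂ h)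
    (hd : T.dist x ((h : T ≃g T) x) =
      T.dist x ((γ₁ : T ≃g T) x) + T.dist x ((γ₂ : T ≃g T) x)) :
    convolutionFiber x γ₁ γ₂ h = (fun k => g⁻¹ * k) ⁻¹' (vertexStabilizer T G x : Set G) := by
  ext k
  refine ⟨fun hk => ?_, fun hk => ?_⟩
  · obtain ⟨g1, g2⟩ := dist_of_mem_convolutionFiber hT hg
    obtain ⟨k1, k2⟩ := dist_of_mem_convolutionFiber hT hk
    have hgk : (g : T ≃g T) x = (k : T ≃g T) x :=
      eq_of_dist_eq_of_dist_add_eq hT (z := (h : T ≃g T)⁻¹ x)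
        (by rw [dist_inv_apply_self hT, hd, g1, g2, add_comm]) (k1.trans g1.symm)
        (k2.trans g2.symm)
    change (g : T ≃g T).symm ((k : T ≃g T) x) = x
    rw [← hgk, RelIso.symm_apply_apply]
  · simpa using mul_mem_convolutionFiber hg hk

lemma measure_convolutionFiber (hT : T.IsTree) [MeasurableSpace G] [BorelSpace G] (μ : Measure G)
    [μ.IsMulLeftInvariant] {γ₁ γ₂ h g : G} (hg : g ∈ convolutionFiber x γ₁ γ₂ h)
    (hd : T.dist x ((h : T ≃g T) x) =
      T.dist x ((γ₁ : T ≃g T) x) + T.dist x ((γ₂ : T ≃g T) x)) :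
    μ (convolutionFiber x γ₁ γ₂ h) = μ (vertexStabilizer T G x : Set G) := by
  rw [convolutionFiber_eq_preimage hT hg hd,
    measure_preimage_mul_left μ _ (isOpen_vertexStabilizer x)]

lemma measure_vertexStabilizer_le [MeasurableSpace G] [BorelSpace G] (μ : Measure G)
    [μ.IsMulLeftInvariant] {γ₁ γ₂ h g : G} (hg : g ∈ convolutionFiber x γ₁ γ₂ h) :
    μ (vertexStabilizer T G x : Set G) ≤ μ (convolutionFiber x γ₁ γ₂ h) := by
  rw [← measure_preimage_mul_left μ g⁻¹ (isOpen_vertexStabilizer x)]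
  refine measure_mono fun k hk => ?_
  simpa using mul_mem_convolutionFiber hg hk

lemma sum_doubleCosetIndicator_apply {n : ℕ} {η : Fin n → G} (c : Fin n → ℂ)
    (hη : Function.Injective (fun i => KDoubleCoset T G x (η i))) (i : Fin n) :
    ∑ j, c j * doubleCosetIndicator T G x (η j) (η i) = c i := by
  classical
  rw [Finset.sum_eq_single i]
  · rw [doubleCosetIndicator_eq_ite, if_pos rfl, mul_one]
  · intro j _ hj
    rw [doubleCosetIndicator_eq_ite, if_neg fun e => hj (hη e), mul_zero]
  · simp

theorem eq_measure_of_isMaximalCoefficient (hT : T.IsTree) (hxy : T.Adj x y) [MeasurableSpace G]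
    [BorelSpace G] (μ : Measure G) [μ.IsMulLeftInvariant] [μ.IsOpenPosMeasure] {γ₁ γ₂ : G}
    (hγ₁ : γ₁ ∈ APlus T G x y) (hγ₂ : γ₂ ∈ APlus T G x y) {a : ℂ}
    (ha : IsMaximalCoefficient T G x y
      (convolution μ (doubleCosetIndicator T G x γ₁) (doubleCosetIndicator T G x γ₂)) a) :
    a = (μ.real (vertexStabilizer T G x : Set G) : ℂ) := by
  obtain ⟨n, η, c, -, hinj, hf, i, ⟨hi, hsupp, hmax⟩, rfl⟩ := ha
  set f := convolution μ (doubleCosetIndicator T G x γ₁) (doubleCosetIndicator T G x γ₂)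
  have hfi : f (η i) = c i := by rw [hf]; exact sum_doubleCosetIndicator_apply c hinj i
  have hval (h : G) : f h = (μ.real (convolutionFiber x γ₁ γ₂ h) : ℂ) :=
    convolution_doubleCosetIndicator μ γ₁ γ₂ h
  have hne : μ.real (convolutionFiber x γ₁ γ₂ (η i)) ≠ 0 := by
    have := hsupp (self_mem_KDoubleCoset (η i))
    rw [Function.mem_support, hval] at this
    exact_mod_cast this
  obtain ⟨g, hg⟩ : (convolutionFiber x γ₁ γ₂ (η i)).Nonempty :=
    Set.nonempty_iff_ne_empty.2 fun e => hne (by rw [e]; simp)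
  -- If `K` had infinite measure, so would the fibre, which contains a coset of `K`; its real
  -- measure would then be 0 by convention, contradicting `hne`.
  have hfin : μ (vertexStabilizer T G x : Set G) ≠ ⊤ := fun e => hne <| by
    have h := measure_vertexStabilizer_le μ hg
    rw [e, top_le_iff] at h
    rw [measureReal_def, h, ENNReal.toReal_top]
  have hpos : μ (vertexStabilizer T G x : Set G) ≠ 0 :=
    (isOpen_vertexStabilizer x).measure_ne_zero μ ⟨1, one_mem _⟩
  obtain ⟨hmem, hlen⟩ := mul_mem_APlus hT hxy hγ₁ hγ₂
  have d₁ := dist_eq_translationLength_of_mem_APlus hγ₁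
  have d₂ := dist_eq_translationLength_of_mem_APlus hγ₂
  have d₁₂ := dist_eq_translationLength_of_mem_APlus hmem
  have dη := dist_eq_translationLength_of_mem_APlus hi
  have hprod : KDoubleCoset T G x (γ₁ * γ₂) ⊆ Function.support f := by
    intro h hh
    have hg' : γ₂⁻¹ ∈ convolutionFiber x γ₁ γ₂ (γ₁ * γ₂) := by
      constructor
      · rw [mul_inv_cancel_right]; exact self_mem_KDoubleCoset γ₁
      · rw [inv_inv]; exact self_mem_KDoubleCoset γ₂
    -- Bi-invariance of `f` under `K` is read off its decomposition into double coset indicators.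
    have hfh : f h = f (γ₁ * γ₂) := by
      rw [hf]
      exact Finset.sum_congr rfl fun j _ => by rw [doubleCosetIndicator_congr hh]
    rw [Function.mem_support, hfh, hval, measureReal_def,
      measure_convolutionFiber hT μ hg' (by omega)]
    exact_mod_cast ENNReal.toReal_ne_zero.2 ⟨hpos, hfin⟩
  -- Maximality against `γ₁ γ₂` bounds the length of `η i` below by `|γ₁| + |γ₂|`, and the triangle
  -- inequality bounds it above, so the single-coset case applies.
  have hle := hmax _ hmem hprod
  have hge := dist_le_of_mem_convolutionFiber hT hg
  rw [← hfi, hval, measureReal_def, measure_convolutionFiber hT μ hg (by omega), measureReal_def]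

end Convolution

end BurgerMozes

theorem proposition3p11 {V : Type*} (T : SimpleGraph V) [T.LocallyFinite] (hT : T.IsTree)
    (d : ℕ) (hd : 3 ≤ d) (hreg : T.IsRegularOfDegree d)
    (ι : T.edgeSet → Fin d) (hι : BurgerMozes.IsLegalColoring T ι)
    (F : Subgroup (Equiv.Perm (Fin d))) (hF : MulAction.IsPreprimitive F (Fin d))
    (x y : V) (hxy : T.Adj x y)
    [MeasurableSpace (BurgerMozes.universalGroupPlus T ι F)]
    [BorelSpace (BurgerMozes.universalGroupPlus T ι F)]
    (μ : MeasureTheory.Measure (BurgerMozes.universalGroupPlus T ι F)) [μ.IsHaarMeasure]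
    (γ₁ γ₂ : BurgerMozes.universalGroupPlus T ι F)
    (hγ₁ : γ₁ ∈ BurgerMozes.APlus T (BurgerMozes.universalGroupPlus T ι F) x y)
    (hγ₂ : γ₂ ∈ BurgerMozes.APlus T (BurgerMozes.universalGroupPlus T ι F) x y) :
    (∀ a : ℂ,
      BurgerMozes.IsMaximalCoefficient T (BurgerMozes.universalGroupPlus T ι F) x y
        (BurgerMozes.convolution μ
          (BurgerMozes.doubleCosetIndicator T (BurgerMozes.universalGroupPlus T ι F) x γ₁)
          (BurgerMozes.doubleCosetIndicator T (BurgerMozes.universalGroupPlus T ι F) x γ₂)) a →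
      a = (μ.real (BurgerMozes.vertexStabilizer T (BurgerMozes.universalGroupPlus T ι F) x :
        Set (BurgerMozes.universalGroupPlus T ι F)) : ℂ)) ∧
    (μ (BurgerMozes.vertexStabilizer T (BurgerMozes.universalGroupPlus T ι F) x :
        Set (BurgerMozes.universalGroupPlus T ι F)) = 1 →
      ∀ a : ℂ,
        BurgerMozes.IsMaximalCoefficient T (BurgerMozes.universalGroupPlus T ι F) x y
          (BurgerMozes.convolution μ
            (BurgerMozes.doubleCosetIndicator T (BurgerMozes.universalGroupPlus T ι F) x γ₁)
            (BurgerMozes.doubleCosetIndicator T (BurgerMozes.universalGroupPlus T ι F) x γ₂)) a →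
        a = 1) := by
  have key : ∀ a : ℂ, _ → a = _ := fun a ha =>
    BurgerMozes.eq_measure_of_isMaximalCoefficient hT hxy μ hγ₁ hγ₂ (a := a) ha
  refine ⟨key, fun hμ a ha => ?_⟩
  rw [key a ha, measureReal_def, hμ]
  simp
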